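/- **Setting.** Let $\mathbb F$ be a field, $n\ge 1$, and compute with indices in $\mathcal I=\{0,\dots,n-1\}$ modulo $n$. For $a,b\in\mathcal I$ let $[a,b]=\{a,\dots,b\}$ if $a\le b$ and $[a,b]=\{a,\dots,n-1,0,\dots,b\}$ if $a>b$, and let $(a,b]=[a,b]\setminus\{a\}$. The interval $(a,b]$ (understood with its endpoints) is a *span* of $c\in\mathbb F^n$ if $c_a\ne0\ne c_b$ and $c_j=0$ for all $j\notin[a,b]$. Vectors are row vectors, and $\operatorname{im}M$ is the row space of a matrix $M$. A *characteristic pair* of a code $\mathcal C\subseteq\mathbb F^n$ of dimension $k$ is a matrix $X\in\mathbb F^{n\times n}$ with $\operatorname{im}X=\mathcal C$ together with a list of intervals $(a_l,b_l]$ such that $(a_l,b_l]$ is a span of the $l$-th row of $X$, the $a_l$ are distinct, the $b_l$ are distinct, and every $j\in\mathcal I$ lies in $(a_l,b_l]$ for exactly $n-k$ indices $l$. For matrices $G=(g_{lj})\in\mathbb F^{r\times n}$, $H\in\mathbb F^{s\times n}$, $D\in\mathbb F^{r\times s}$, with columns $G_j^{\mathsf T}$ and $H_j^{\mathsf T}$,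 put $N_0=D$ and $N_i=N_{i-1}+G_{i-1}^{\mathsf T}H_{i-1}$ for $0<i<n$. The trellis $T_{(G,H,D)}$ has state spaces $V_j=\operatorname{im}N_j$ and transition spaces $E_j=\operatorname{im}(N_j,G_j^{\mathsf T},N_{j+1})\subseteq V_j\times\mathbb F\times V_{j+1}$ for $j\in\mathcal I$, where $N_n:=N_0$. Its *BCJR-dual* is $T_{(G,H,D)}^{\perp}:=T_{(H,G,D^{\mathsf T})}$. If $\mathcal S=[(a_l,b_l]\mid l]$ is a list of spans of the rows of $G$, then $T_{(G,H,\mathcal S)}:=T_{(G,H,D)}$, where the $l$-th row of $D$ is $\sum_{j=a_l}^{n-1}g_{lj}H_j$. **Data.** Let $\mathcal C\subseteq\mathbb F^n$ be a $k$-dimensional code such that for every $j\in\mathcal I$ both $\mathcal C$ and $\mathcal C^\perp$ contain a word whose $j$-th entry is nonzero. Let $H\in\mathbb F^{(n-k)\times n}$ have full row rank and $\mathcal C=\ker H^{\mathsf T}$. Let $(X,\mathcal T)$ be a characteristic pair of $\mathcal C$, with rows indexed by $0,\dots,n-1$ and sorted so that $\mathcal T=[(a_l,l]\mid l=0,\dots,n-1]$.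 Let $N_j$ be the state space matrices of $T_{(X,H,\mathcal T)}$, and for $m\in\mathcal I$ let $X^m$, $N_j^m$ arise from $X$, $N_j$ by deleting row $m$. **Theorem.** For each $m\in\mathcal I$ there is exactly one $v_m\in\mathbb F^{n-k}$ such that the $m$-th column of $X^m$ equals $N^m_{m+1}v_m^{\mathsf T}$. Let $Y\in\mathbb F^{n\times n}$ be the matrix with rows $v_0H,\dots,v_{n-1}H$. Then $(Y,[(m,a_m]\mid m=0,\dots,n-1])$ is a characteristic pair of $\mathcal C^\perp$. Moreover, let $\mathcal I=\mathcal K\,\dot\cup\,\hat{\mathcal K}$ with $|\mathcal K|=k$, let $\tilde X$ consist of the rows of $X$ with index in $\mathcal K$ and $\tilde Y$ of the rows of $Y$ with index in $\hat{\mathcal K}$, and let $\mathcal S=[(a_l,l]\mid l\in\mathcal K]$, $\hat{\mathcal S}=[(m,a_m]\mid m\in\hat{\mathcal K}]$. If $\operatorname{rk}\tilde X=k$, then $\tilde X$ and $\tilde Y$ have full row rank, $\operatorname{im}\tilde X=\ker\tilde Y^{\mathsf T}=\mathcal C$ and $\operatorname{im}\tilde Y=\ker\tilde X^{\mathsf T}=\mathcal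 C^\perp$, and $$T_{(\tilde X,\tilde Y,\mathcal S)}^{\perp}=T_{(\tilde Y,\tilde X,\hat{\mathcal S})},$$ that is, the two trellises have the same state spaces and the same transition spaces at every time $j\in\mathcal I$. -/

import Mathlib

open Matrix

namespace TailBiting

section Codes

variable {F : Type*} [Field F] {n : ℕ}

/-- The dual code of `C ⊆ Fⁿ` with respect to the standard bilinear form. -/
def dualCode (C : Submodule F (Fin n → F)) : Submodule F (Fin n → F) where
  carrier := {y | ∀ c ∈ C, c ⬝ᵥ y = 0}
  add_mem' := by
    intro y z hy hz c hc
    rw [dotProduct_add, hy c hc, hz c hc, add_zero]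
  zero_mem' := by
    intro c _
    exact dotProduct_zero c
  smul_mem' := by
    intro t y hy c hc
    rw [dotProduct_smul, hy c hc, smul_zero]

/-- The code `C` has full support: every coordinate is nonzero for some codeword. -/
def HasFullSupport (C : Submodule F (Fin n → F)) : Prop :=
  ∀ j, ∃ c ∈ C, c j ≠ 0

/-- The row space `im M = {α M}` of a matrix. -/
def rowSpace {ι κ : Type*} (M : Matrix ι κ F) : Submodule F (κ → F) :=
  Submodule.span F (Set.range M.row)

/-- `C = im G = ker Hᵀ`, where `H` has full row rank: `G` is a (possibly redundant) generator
matrix and `H` a parity check matrix of `C`. -/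
structure IsGenParity {ι κ : Type*} (C : Submodule F (Fin n → F))
    (G : Matrix ι (Fin n) F) (H : Matrix κ (Fin n) F) : Prop where
  rowSpace_eq : rowSpace G = C
  mem_iff : ∀ c, c ∈ C ↔ H *ᵥ c = 0
  linearIndependent : LinearIndependent F H.row

/-- The closed cyclic interval `[a, b]` in the time axis `{0, …, n - 1}`. -/
def cIcc (a b : Fin n) : Finset (Fin n) :=
  if a ≤ b then Finset.univ.filter (fun j => a ≤ j ∧ j ≤ b)
  else Finset.univ.filter (fun j => a ≤ j ∨ j ≤ b)

/-- The half-open cyclic interval `(a, b] = [a, b] \ {a}`. -/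
def cIoc (a b : Fin n) : Finset (Fin n) :=
  (cIcc a b).erase a

/-- The interval `(s.1, s.2]` is a span of the vector `c`. -/
def IsSpan (c : Fin n → F) (s : Fin n × Fin n) : Prop :=
  c s.1 ≠ 0 ∧ c s.2 ≠ 0 ∧ ∀ j, c j ≠ 0 → j ∈ cIcc s.1 s.2

/-- `(X, T)` is a characteristic pair of the code `C`; the `l`-th span is `(a, b]`
with `(a, b) = T l`. -/
structure IsCharPair (C : Submodule F (Fin n → F)) (X : Matrix (Fin n) (Fin n) F)
    (T : Fin n → Fin n × Fin n) : Prop where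
  rowSpace_eq : rowSpace X = C
  isSpan : ∀ l, IsSpan (X.row l) (T l)
  start_injective : Function.Injective (fun l => (T l).1)
  end_injective : Function.Injective (fun l => (T l).2)
  card_active : ∀ j,
    (Finset.univ.filter (fun l => j ∈ cIoc (T l).1 (T l).2)).card = n - Module.finrank F C

end Codes

/-- A linear tail-biting trellis of depth `n` over `F`, all of whose state spaces are subspaces
of one ambient space `W` (the vertex set is the disjoint union of the state spaces).  An edge from
the state `v` at time `j` to the state `w` at time `j + 1` (modulo `n`) with label `x` is the
triple `(v, x, w)`. -/
@[ext]
structure LinearTrellis (F : Type*) [Field F] (n : ℕ) [NeZero n]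
    (W : Type*) [AddCommGroup W] [Module F W] where
  state : Fin n → Submodule F W
  edge : Fin n → Submodule F (W × F × W)
  edge_le : ∀ j, edge j ≤ (state j).prod ((⊤ : Submodule F F).prod (state (j + 1)))

/-- The data `(G, H, D)` of a trellis `T_(G,H,D)`: a generator matrix, a parity check matrix
and a displacement matrix. -/
@[ext]
structure TrellisData (F : Type*) (n : ℕ) (ι κ : Type*) where
  G : Matrix ι (Fin n) F
  H : Matrix κ (Fin n) F
  D : Matrix ι κ F

namespace TrellisData

variable {F : Type*} [Field F] {n : ℕ} {ι κ : Type*}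

/-- The state space matrices: `N_0 = D` and `N_i = N_(i-1) + (column i-1 of G) (column i-1 of H)ᵀ`,
that is, `N_i = D + ∑_{j < i} (column j of G) (column j of H)ᵀ`. -/
def stateMatrix (d : TrellisData F n ι κ) (i : Fin n) : Matrix ι κ F :=
  d.D + ∑ j ∈ Finset.univ.filter (fun j => j < i), vecMulVec (d.G.col j) (d.H.col j)

/-- The trellis `T_(G,H,D)` with state spaces `im N_j` and transition spaces
`im (N_j, column j of G, N_(j+1))`, the time being taken modulo `n`. -/
def trellis [NeZero n] (d : TrellisData F n ι κ) : LinearTrellis F n (κ → F) where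
  state j := rowSpace (d.stateMatrix j)
  edge j := Submodule.span F (Set.range fun l =>
    ((d.stateMatrix j).row l, d.G l j, (d.stateMatrix (j + 1)).row l))
  edge_le j := by
    rw [Submodule.span_le]
    rintro _ ⟨l, rfl⟩
    exact ⟨Submodule.subset_span ⟨l, rfl⟩, trivial, Submodule.subset_span ⟨l, rfl⟩⟩

/-- The data of the BCJR-dual: the BCJR-dual of `T_(G,H,D)` is `T_(H,G,Dᵀ)`. -/
def dual (d : TrellisData F n ι κ) : TrellisData F n κ ι :=
  ⟨d.H, d.G, d.Dᵀ⟩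

/-- The data of the BCJR-trellis `T_(G,H,S)` for a span list `S` of `G`: row `l` of the
displacement matrix is `∑_{j = a}^{n-1} g_lj H_j`, where `a` is the starting point of the
`l`-th span and `H_j` is the `j`-th column of `H`. -/
def ofSpans (G : Matrix ι (Fin n) F) (H : Matrix κ (Fin n) F)
    (S : ι → Fin n × Fin n) : TrellisData F n ι κ :=
  ⟨G, H, Matrix.of fun l => ∑ j ∈ Finset.univ.filter (fun j => (S l).1 ≤ j), G l j • H.col j⟩

end TrellisData

section Construction

variable {F : Type*} [Field F] {n : ℕ} [NeZero n] {κ : Type*} [Fintype κ]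

/-- The equation that determines the dual state `v = v_m`: with `N_j` the state space matrices of
`T_(X,H,T)`, and after deleting the `m`-th row of all matrices, the `m`-th column of `X` equals
`N_(m+1) vᵀ`. -/
def IsDualState (X : Matrix (Fin n) (Fin n) F) (H : Matrix κ (Fin n) F)
    (T : Fin n → Fin n × Fin n) (m : Fin n) (v : κ → F) : Prop :=
  ∀ l, l ≠ m →
    X l m = ((TrellisData.ofSpans X H T).stateMatrix (m + 1)).row l ⬝ᵥ v

/-- The matrix `Y` whose `m`-th row is the dual codeword `v_m H`. -/
def dualMatrix (H : Matrix κ (Fin n) F) (v : Fin n → κ → F) : Matrix (Fin n) (Fin n) F :=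
  Matrix.of fun m => v m ᵥ* H

end Construction

/-- The submatrix of `M` that consists of the rows with index in `K`. -/
def selectRows {F : Type*} {n : ℕ} (M : Matrix (Fin n) (Fin n) F) (K : Finset (Fin n)) :
    Matrix K (Fin n) F :=
  M.submatrix Subtype.val id

end TailBiting

/-! Everything is read off from the pairings of the rows `N_(j,l)` of the state matrices with a
vector `w`. Putting `y = wH`, one time step adds `X_(lj) y_j` to the pairing, cyclically as `H`
checks `X`, and `N_(j,l) = 0` for `j` outside `(a_l, l]`. At each time exactly one row of `X` starts
and exactly one ends. The row ending at `j` gives: if `w` pairs to zero with all rows at one time,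
then `y = 0`, so `w = 0`. Hence the `n - k` active rows at `m + 1` form an invertible matrix, and
`v_m` exists uniquely.

The rows starting at a given time determine `y = v_m H`: `y_m = 1`, so at time `m` only row `m`
pairs nontrivially with `v_m`; going backward, `y_j = 0` strictly between `a_m` and `m`. This gives
the span `(m, a_m]`. The relation `N_(m,l) v_mᵀ = 0` for `l ≠ m`
(`stateRow_dotProduct_self_eq_zero`) also yields the independence of the complementary rows of `Y`,
and, compared with `X_l ⬝ᵥ Y_m = 0`, the equality of the displacement matrices up to transposition.
-/

namespace TailBiting

/-! ### Cyclic time axis and intervals -/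

section Cyclic

variable {n : ℕ}

theorem val_add_one [NeZero n] (j : Fin n) :
    ((j + 1 : Fin n) : ℕ) = if (j : ℕ) + 1 = n then 0 else (j : ℕ) + 1 := by
  have hj := j.isLt
  rw [Fin.val_add, Fin.val_one', Nat.add_mod_mod]
  split_ifs with h
  · rw [h, Nat.mod_self]
  · exact Nat.mod_eq_of_lt (by omega)

/-- Forward induction along the cyclic time axis. -/
theorem cyclic_induction [NeZero n] {P : Fin n → Prop} (a : Fin n) (ha : P a)
    (h : ∀ j, P j → P (j + 1)) (j : Fin n) : P j := by
  have key : ∀ t : ℕ, P (a + Fin.ofNat n t) := by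
    intro t
    induction t with
    | zero => simpa using ha
    | succ t ih =>
      have : a + Fin.ofNat n (t + 1) = a + Fin.ofNat n t + 1 := by
        rw [add_assoc]
        congr 1
        ext
        simp [Fin.val_add]
      rw [this]
      exact h _ ih
  have := key ((j - a : Fin n) : ℕ)
  rwa [Fin.ofNat_val_eq_self, add_sub_cancel] at this

/-- Backward induction along the cyclic time axis. -/
theorem cyclic_induction_backward [NeZero n] {P : Fin n → Prop} (a : Fin n) (ha : P a)
    (h : ∀ j, P (j + 1) → P j) (j : Fin n) : P j := by
  by_contra hj
  exact cyclic_induction (P := fun i => ¬ P i) j hj (fun i hi hi' => hi (h i hi')) a ha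

theorem mem_cIcc {a b j : Fin n} :
    j ∈ cIcc a b ↔ if a ≤ b then a ≤ j ∧ j ≤ b else a ≤ j ∨ j ≤ b := by
  unfold cIcc
  split_ifs <;> simp

theorem mem_cIoc {a b j : Fin n} : j ∈ cIoc a b ↔ j ≠ a ∧ j ∈ cIcc a b := by
  simp [cIoc]

theorem mem_cIcc_self {a j : Fin n} : j ∈ cIcc a a ↔ j = a := by
  rw [mem_cIcc, if_pos le_rfl, Fin.le_def, Fin.le_def, Fin.ext_iff]
  omega

theorem left_mem_cIcc (a b : Fin n) : a ∈ cIcc a b := by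
  rw [mem_cIcc]
  split_ifs with h
  · exact ⟨le_rfl, h⟩
  · exact Or.inl le_rfl

theorem add_one_mem_cIoc [NeZero n] {a b j : Fin n} :
    j + 1 ∈ cIoc a b ↔ j ∈ cIcc a b ∧ j ≠ b := by
  have := val_add_one j
  have h1 := j.isLt
  have h2 := a.isLt
  have h3 := b.isLt
  simp only [mem_cIoc, mem_cIcc, Fin.le_def, ne_eq, Fin.ext_iff, this]
  clear this
  split_ifs <;> omega

theorem mem_cIoc_swap {a b j : Fin n} (h : a ≠ b) : j ∈ cIoc b a ↔ j ∉ cIoc a b := by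
  simp only [mem_cIoc, mem_cIcc, Fin.le_def, ne_eq, Fin.ext_iff] at *
  split_ifs <;> omega

theorem mem_cIcc_swap {a b j : Fin n} (hab : a ≠ b) (h : j ∉ cIoc a b ∨ j = b) : j ∈ cIcc b a := by
  simp only [mem_cIoc, mem_cIcc, Fin.le_def, ne_eq, Fin.ext_iff] at *
  split_ifs at * <;> omega

end Cyclic

/-! ### Dual codes and parity checks -/

section DualCode

variable {F : Type*} [Field F] {n : ℕ} {ι κ : Type*}

theorem mem_dualCode {C : Submodule F (Fin n → F)} {y : Fin n → F} :
    y ∈ dualCode C ↔ ∀ c ∈ C, c ⬝ᵥ y = 0 := Iff.rfl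

theorem mem_dualCode_rowSpace {A : Matrix ι (Fin n) F} {y : Fin n → F} :
    y ∈ dualCode (rowSpace A) ↔ A *ᵥ y = 0 := by
  rw [mem_dualCode]
  constructor
  · intro h
    ext l
    exact h _ (Submodule.subset_span ⟨l, rfl⟩)
  · intro h c hc
    induction hc using Submodule.span_induction with
    | mem x hx =>
      obtain ⟨l, rfl⟩ := hx
      exact congrFun h l
    | zero => exact zero_dotProduct y
    | add x z _ _ hx hz => rw [add_dotProduct, hx, hz, add_zero]
    | smul t x _ hx => rw [smul_dotProduct, hx, smul_zero]

theorem finrank_rowSpace [Fintype ι] (A : Matrix ι (Fin n) F) :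
    Module.finrank F (rowSpace A) = A.rank :=
  (Matrix.rank_eq_finrank_span_row A).symm

theorem finrank_add_finrank_dualCode (C : Submodule F (Fin n → F)) :
    Module.finrank F C + Module.finrank F (dualCode C) = n := by
  let b := Module.finBasis F C
  let A : Matrix (Fin (Module.finrank F C)) (Fin n) F := Matrix.of fun i => (b i : Fin n → F)
  have hA : rowSpace A = C := by
    have : Set.range A.row = C.subtype '' Set.range b := by
      rw [← Set.range_comp]
      rfl
    rw [rowSpace, this, Submodule.span_image, b.span_eq, Submodule.map_top, Submodule.range_subtype]
  have hker : dualCode C = LinearMap.ker A.mulVecLin := by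
    ext y
    rw [LinearMap.mem_ker, mulVecLin_apply, ← mem_dualCode_rowSpace, hA]
  have h := A.mulVecLin.finrank_range_add_finrank_ker
  rw [← hker, Module.finrank_fin_fun] at h
  have h' := finrank_rowSpace A
  rw [hA] at h'
  rw [h']
  exact h

theorem dualCode_dualCode (C : Submodule F (Fin n → F)) : dualCode (dualCode C) = C := by
  refine (Submodule.eq_of_le_of_finrank_eq (fun c hc y hy => ?_) ?_).symm
  · rw [dotProduct_comm]
    exact hy c hc
  · have h1 := finrank_add_finrank_dualCode C
    have h2 := finrank_add_finrank_dualCode (dualCode C)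
    omega

theorem isGenParity_of_rowSpace_eq {C : Submodule F (Fin n → F)} {A : Matrix ι (Fin n) F}
    {B : Matrix κ (Fin n) F} (hA : rowSpace A = C) (hB : rowSpace B = dualCode C)
    (hli : LinearIndependent F B.row) : IsGenParity C A B where
  rowSpace_eq := hA
  mem_iff c := by rw [← mem_dualCode_rowSpace, hB, dualCode_dualCode]
  linearIndependent := hli

theorem vecMul_mem_dualCode [Fintype κ] {C : Submodule F (Fin n → F)} {H : Matrix κ (Fin n) F}
    (hH : ∀ c ∈ C, H *ᵥ c = 0) (w : κ → F) : w ᵥ* H ∈ dualCode C := by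
  intro c hc
  rw [dotProduct_comm, ← dotProduct_mulVec, hH c hc, dotProduct_zero]

theorem eq_zero_of_vecMul_eq_zero [Fintype κ] {H : Matrix κ (Fin n) F}
    (hH : LinearIndependent F H.row) {w : κ → F} (h : w ᵥ* H = 0) : w = 0 := by
  refine Matrix.vecMul_injective_iff.2 hH ?_
  simpa using h

end DualCode

/-! ### Evolution of the rows of the state matrices -/

namespace TrellisData

variable {F : Type*} [Field F] {n : ℕ} {ι κ : Type*}

theorem sum_smul_col (H : Matrix κ (Fin n) F) (c : Fin n → F) :
    ∑ j, c j • H.col j = H *ᵥ c := by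
  ext q
  simp [Finset.sum_apply, mulVec, dotProduct, mul_comm]

theorem stateMatrix_row (d : TrellisData F n ι κ) (i : Fin n) (l : ι) :
    (d.stateMatrix i).row l =
      d.D l + ∑ j ∈ Finset.univ.filter (fun j => j < i), d.G l j • d.H.col j := by
  ext q
  simp [stateMatrix, Matrix.sum_apply, vecMulVec_apply]

/-- At the wrap-around `i = n - 1` the accumulated sum is the whole syndrome of the row, which is
zero by `h`, so the recursion also holds there. -/
theorem stateMatrix_row_add_one [NeZero n] (d : TrellisData F n ι κ) {l : ι}
    (h : d.H *ᵥ d.G l = 0) (i : Fin n) :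
    (d.stateMatrix (i + 1)).row l = (d.stateMatrix i).row l + d.G l i • d.H.col i := by
  rw [stateMatrix_row, stateMatrix_row, add_assoc]
  congr 1
  have hi : i ∉ Finset.univ.filter (fun j => j < i) := by simp
  rw [add_comm (∑ j ∈ _, _), ← Finset.sum_insert (f := fun j => d.G l j • d.H.col j) hi]
  have hval := val_add_one i
  by_cases hn : (i : ℕ) + 1 = n
  · rw [if_pos hn] at hval
    have h1 : Finset.univ.filter (fun j : Fin n => j < i + 1) = ∅ := by
      ext j
      simp [Fin.lt_def, hval]
    have h2 : insert i (Finset.univ.filter (fun j => j < i)) = Finset.univ := by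
      ext j
      have := j.isLt
      simp only [Finset.mem_insert, Finset.mem_filter, Finset.mem_univ, true_and, iff_true,
        Fin.lt_def, Fin.ext_iff]
      omega
    rw [h1, h2, sum_smul_col, h, Finset.sum_empty]
  · rw [if_neg hn] at hval
    congr 1
    ext j
    simp only [Finset.mem_insert, Finset.mem_filter, Finset.mem_univ, true_and,
      Fin.lt_def, Fin.ext_iff, hval]
    omega

/-- The displacement sums over `j ≥ a` and the state matrix at time `a` adds the terms `j < a`;
together they form the full syndrome. -/
theorem ofSpans_row_start (G : Matrix ι (Fin n) F) (H : Matrix κ (Fin n) F)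
    (S : ι → Fin n × Fin n) {l : ι} (h : H *ᵥ G l = 0) :
    ((ofSpans G H S).stateMatrix (S l).1).row l = 0 := by
  rw [stateMatrix_row, ← h, ← sum_smul_col]
  have := Finset.sum_filter_add_sum_filter_not Finset.univ (fun j => (S l).1 ≤ j)
    (fun j => G l j • H.col j)
  simp only [not_le] at this
  exact this

theorem ofSpans_row_eq_zero [NeZero n] {G : Matrix ι (Fin n) F} {H : Matrix κ (Fin n) F}
    {S : ι → Fin n × Fin n} {l : ι} (h : H *ᵥ G l = 0) (hS : IsSpan (G.row l) (S l)) {j : Fin n}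
    (hj : j ∉ cIoc (S l).1 (S l).2) : ((ofSpans G H S).stateMatrix j).row l = 0 := by
  revert hj
  refine cyclic_induction_backward (P := fun j => j ∉ cIoc (S l).1 (S l).2 →
    ((ofSpans G H S).stateMatrix j).row l = 0) (S l).1
    (fun _ => ofSpans_row_start G H S h) (fun j ih hj => ?_) j
  by_cases hja : j = (S l).1
  · rw [hja, ofSpans_row_start G H S h]
  · have hmem : j ∉ cIcc (S l).1 (S l).2 := fun h' => hj (mem_cIoc.2 ⟨hja, h'⟩)
    have hz : G l j = 0 := by
      by_contra h0
      exact hmem (hS.2.2 j h0)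
    have hrow := ih fun h' => hmem (add_one_mem_cIoc.1 h').1
    rw [stateMatrix_row_add_one (ofSpans G H S) h] at hrow
    have hz' : (ofSpans G H S).G l j = 0 := hz
    rwa [hz', zero_smul, add_zero] at hrow

end TrellisData

/-! ### Dual states and the spans of the dual codewords -/

section CharPair

open TrellisData

variable {F : Type*} [Field F] {n : ℕ} {κ : Type*}
  {C : Submodule F (Fin n → F)} {a : Fin n → Fin n} {X : Matrix (Fin n) (Fin n) F}
  {H : Matrix κ (Fin n) F} {w : κ → F}

/-- Otherwise row `m` of `X` would be supported on `m` alone, forcing every dual word to vanish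
there. -/
theorem IsCharPair.start_ne (hX : IsCharPair C X (fun l => (a l, l)))
    (hC' : HasFullSupport (dualCode C)) (m : Fin n) : a m ≠ m := by
  intro h
  obtain ⟨y, hy, hym⟩ := hC' m
  obtain ⟨-, h2, h3⟩ := hX.isSpan m
  have h0 := hy (X.row m) (hX.rowSpace_eq ▸ Submodule.subset_span ⟨m, rfl⟩)
  rw [dotProduct, Finset.sum_eq_single m] at h0
  · exact mul_ne_zero h2 hym h0
  · intro j _ hj
    by_contra hne
    have := h3 j (left_ne_zero_of_mul hne)
    rw [h] at this
    exact hj (mem_cIcc_self.1 this)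
  · simp

theorem IsCharPair.exists_start (hX : IsCharPair C X (fun l => (a l, l))) (j : Fin n) :
    ∃ l, a l = j :=
  Finite.surjective_of_injective hX.start_injective j

theorem IsGenParity.mulVec_eq_zero {ι : Type*} {X : Matrix ι (Fin n) F}
    (hH : IsGenParity C X H) (l : ι) : H *ᵥ X l = 0 :=
  (hH.mem_iff _).1 (hH.rowSpace_eq ▸ Submodule.subset_span ⟨l, rfl⟩)

/-- Row `l` of the state matrix of `T_(X,H,T)` at time `j`. -/
abbrev stateRow (X : Matrix (Fin n) (Fin n) F) (H : Matrix κ (Fin n) F) (a : Fin n → Fin n)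
    (j l : Fin n) : κ → F :=
  ((ofSpans X H (fun l => (a l, l))).stateMatrix j).row l

variable [NeZero n]

theorem stateRow_eq_zero (hX : IsCharPair C X (fun l => (a l, l))) (hH : IsGenParity C X H)
    {j l : Fin n} (h : j ∉ cIoc (a l) l) : stateRow X H a j l = 0 :=
  ofSpans_row_eq_zero (S := fun l => (a l, l)) (hH.mulVec_eq_zero l) (hX.isSpan l) h

variable [Fintype κ]

theorem stateRow_add_one_dotProduct (hH : IsGenParity C X H) (w : κ → F) (j l : Fin n) :
    stateRow X H a (j + 1) l ⬝ᵥ w = stateRow X H a j l ⬝ᵥ w + X l j * (w ᵥ* H) j := by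
  have := stateMatrix_row_add_one (ofSpans X H (fun l => (a l, l))) (hH.mulVec_eq_zero l) j
  rw [stateRow, this, add_dotProduct, smul_dotProduct]
  congr 1
  exact congrArg (X l j * ·) (dotProduct_comm _ _)

/-- The rows of each state matrix span the whole space. -/
theorem eq_zero_of_stateRow_dotProduct_eq_zero (hX : IsCharPair C X (fun l => (a l, l)))
    (hH : IsGenParity C X H) {j : Fin n} (h : ∀ l, stateRow X H a j l ⬝ᵥ w = 0) : w = 0 := by
  have step : ∀ i, (∀ l, stateRow X H a i l ⬝ᵥ w = 0) → (w ᵥ* H) i = 0 := by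
    intro i hi
    -- Row `i` of `X` ends at `i`, so its state at time `i + 1` is zero.
    have h1 := stateRow_add_one_dotProduct (a := a) hH w i i
    rw [stateRow_eq_zero hX hH fun h' => (add_one_mem_cIoc.1 h').2 rfl, hi, zero_dotProduct,
      zero_add] at h1
    exact (mul_eq_zero.1 h1.symm).resolve_left (hX.isSpan i).2.1
  have all := cyclic_induction (P := fun i => ∀ l, stateRow X H a i l ⬝ᵥ w = 0) j h
    fun i hi l => by rw [stateRow_add_one_dotProduct hH, hi, step i hi, mul_zero, add_zero]
  exact eq_zero_of_vecMul_eq_zero hH.linearIndependent (funext fun i => step i (all i))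

theorem existsUnique_isDualState (hX : IsCharPair C X (fun l => (a l, l)))
    (hH : IsGenParity C X H) (hκ : Fintype.card κ = n - Module.finrank F C)
    (m : Fin n) : ∃! v, IsDualState X H (fun l => (a l, l)) m v := by
  let A := Finset.univ.filter (fun l => m + 1 ∈ cIoc (a l) l)
  have hm : ∀ l, m + 1 ∈ cIoc (a l) l → l ≠ m := by
    rintro l hl rfl
    exact (add_one_mem_cIoc.1 hl).2 rfl
  let f : (κ → F) →ₗ[F] (A → F) :=
    (Matrix.of fun l : A => stateRow X H a (m + 1) l).mulVecLin
  have hf : Function.Injective f := by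
    rw [← LinearMap.ker_eq_bot, LinearMap.ker_eq_bot']
    intro w hw
    refine eq_zero_of_stateRow_dotProduct_eq_zero (j := m + 1) hX hH fun l => ?_
    by_cases hl : m + 1 ∈ cIoc (a l) l
    · exact congrFun hw ⟨l, by simp [A, hl]⟩
    · rw [stateRow_eq_zero hX hH hl, zero_dotProduct]
  have hdim : Module.finrank F (κ → F) = Module.finrank F (A → F) := by
    rw [Module.finrank_fintype_fun_eq_card, Module.finrank_fintype_fun_eq_card, hκ,
      ← hX.card_active (m + 1), Fintype.card_coe]
  obtain ⟨v, hv⟩ := (LinearMap.injective_iff_surjective_of_finrank_eq_finrank hdim).1 hf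
    (fun l => X l m)
  refine ⟨v, fun l hl => ?_, fun v' hv' => hf ?_⟩
  · by_cases hl' : m + 1 ∈ cIoc (a l) l
    · exact (congrFun hv ⟨l, by simp [A, hl']⟩).symm
    -- An inactive row `l ≠ m` imposes no condition: if `X l m ≠ 0`, its span would continue past
    -- `m` and the row would be active at `m + 1`.
    · change X l m = stateRow X H a (m + 1) l ⬝ᵥ v
      rw [stateRow_eq_zero hX hH hl', zero_dotProduct]
      by_contra h0
      exact hl' (add_one_mem_cIoc.2 ⟨(hX.isSpan l).2.2 m h0, hl.symm⟩)
  · rw [hv]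
    ext l
    exact (hv' l (hm l (Finset.mem_filter.1 l.2).2)).symm

/-- The row starting at `m` has zero state at time `m`, so the defining equation reads `X l m = X l
m * y_m` with `X l m ≠ 0`. -/
theorem vecMul_apply_self_eq_one (hX : IsCharPair C X (fun l => (a l, l)))
    (hH : IsGenParity C X H) {m : Fin n} (ham : a m ≠ m)
    (hw : IsDualState X H (fun l => (a l, l)) m w) : (w ᵥ* H) m = 1 := by
  obtain ⟨l, hl⟩ := hX.exists_start m
  have hlm : l ≠ m := by
    rintro rfl
    exact ham hl
  have h1 : X l m = stateRow X H a (m + 1) l ⬝ᵥ w := hw l hlm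
  have h0 : m ∉ cIoc (a l) l := by simp [mem_cIoc, hl]
  rw [stateRow_add_one_dotProduct hH, stateRow_eq_zero hX hH h0, zero_dotProduct, zero_add] at h1
  have hne : X l m ≠ 0 := hl ▸ (hX.isSpan l).1
  exact mul_left_cancel₀ hne (by rw [← h1, mul_one])

theorem stateRow_dotProduct_self_eq_zero (hX : IsCharPair C X (fun l => (a l, l)))
    (hH : IsGenParity C X H) {m : Fin n} (ham : a m ≠ m)
    (hw : IsDualState X H (fun l => (a l, l)) m w) {l : Fin n} (hl : l ≠ m) :
    stateRow X H a m l ⬝ᵥ w = 0 := by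
  have h1 : X l m = stateRow X H a (m + 1) l ⬝ᵥ w := hw l hl
  rw [stateRow_add_one_dotProduct hH, vecMul_apply_self_eq_one hX hH ham hw, mul_one] at h1
  exact right_eq_add.1 h1

theorem stateRow_dotProduct_ne_zero (hX : IsCharPair C X (fun l => (a l, l)))
    (hH : IsGenParity C X H) {m : Fin n} (ham : a m ≠ m)
    (hw : IsDualState X H (fun l => (a l, l)) m w) :
    stateRow X H a m m ⬝ᵥ w ≠ 0 := by
  intro h
  have h0 : w = 0 := eq_zero_of_stateRow_dotProduct_eq_zero (j := m) hX hH fun l => by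
    by_cases hl : l = m
    · rw [hl, h]
    · exact stateRow_dotProduct_self_eq_zero hX hH ham hw hl
  have h1 := vecMul_apply_self_eq_one hX hH ham hw
  simp [h0] at h1

theorem vecMul_apply_eq_zero_of_add_one (hX : IsCharPair C X (fun l => (a l, l)))
    (hH : IsGenParity C X H) {m j : Fin n} (hj : j ≠ a m)
    (h : ∀ l, l ≠ m → stateRow X H a (j + 1) l ⬝ᵥ w = 0) : (w ᵥ* H) j = 0 := by
  obtain ⟨l, hl⟩ := hX.exists_start j
  have hlm : l ≠ m := by
    rintro rfl
    exact hj hl.symm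
  have h1 := h l hlm
  have h0 : j ∉ cIoc (a l) l := by simp [mem_cIoc, hl]
  rw [stateRow_add_one_dotProduct hH, stateRow_eq_zero hX hH h0, zero_dotProduct, zero_add] at h1
  exact (mul_eq_zero.1 h1).resolve_left (hl ▸ (hX.isSpan l).1)

/-- Backward from `m`: when the pairings vanish at `j + 1`, the row starting at `j` forces `y_j =
0`, so they vanish at `j` too. This stops at `a m`, where the starting row is the excluded row `m`.
-/
theorem stateRow_dotProduct_eq_zero_of_mem (hX : IsCharPair C X (fun l => (a l, l)))
    (hH : IsGenParity C X H) {m : Fin n} (ham : a m ≠ m)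
    (hw : IsDualState X H (fun l => (a l, l)) m w) {j : Fin n} (hj : j ∈ cIoc (a m) m)
    {l : Fin n} (hl : l ≠ m) : stateRow X H a j l ⬝ᵥ w = 0 := by
  revert hj l
  refine cyclic_induction_backward (P := fun j => j ∈ cIoc (a m) m →
    ∀ {l : Fin n}, l ≠ m → stateRow X H a j l ⬝ᵥ w = 0) m
    (fun _ => stateRow_dotProduct_self_eq_zero hX hH ham hw) (fun j ih hj l hl => ?_) j
  by_cases hjm : j = m
  · rw [hjm]
    exact stateRow_dotProduct_self_eq_zero hX hH ham hw hl
  · have hj' := mem_cIoc.1 hj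
    have ih' := fun l hl => @ih (add_one_mem_cIoc.2 ⟨hj'.2, hjm⟩) l hl
    have h1 := ih' l hl
    rwa [stateRow_add_one_dotProduct hH, vecMul_apply_eq_zero_of_add_one hX hH hj'.1 ih',
      mul_zero, add_zero] at h1

theorem isSpan_vecMul (hX : IsCharPair C X (fun l => (a l, l)))
    (hH : IsGenParity C X H) {m : Fin n} (ham : a m ≠ m)
    (hw : IsDualState X H (fun l => (a l, l)) m w) : IsSpan (w ᵥ* H) (m, a m) := by
  have h1 := vecMul_apply_self_eq_one hX hH ham hw
  refine ⟨h1 ▸ one_ne_zero, fun h0 => ?_, fun j hj => mem_cIcc_swap ham ?_⟩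
  -- If `y` vanished at `a m`, the pairings would vanish at that time for `l ≠ m` by one more
  -- backward step, and for `l = m` because row `m` starts there.
  · have hw0 : w = 0 := eq_zero_of_stateRow_dotProduct_eq_zero (j := a m) hX hH fun l => by
      by_cases hl : l = m
      · have : a m ∉ cIoc (a l) l := by simp [mem_cIoc, hl]
        rw [stateRow_eq_zero hX hH this, zero_dotProduct]
      · have hmem : a m + 1 ∈ cIoc (a m) m :=
          add_one_mem_cIoc.2 ⟨left_mem_cIcc (a m) m, ham⟩
        have h2 := stateRow_dotProduct_eq_zero_of_mem hX hH ham hw hmem hl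
        rwa [stateRow_add_one_dotProduct hH, h0, mul_zero, add_zero] at h2
    simp [hw0] at h1
  · by_contra! hcon
    have hj' := mem_cIoc.1 hcon.1
    exact hj (vecMul_apply_eq_zero_of_add_one hX hH hj'.1 fun l hl =>
      stateRow_dotProduct_eq_zero_of_mem hX hH ham hw
        (add_one_mem_cIoc.2 ⟨hj'.2, hcon.2⟩) hl)

end CharPair

/-! ### The dual characteristic pair and the dual trellis -/

section Duality

open TrellisData

variable {F : Type*} [Field F] {n : ℕ} {κ : Type*} [Fintype κ]
  {C : Submodule F (Fin n → F)} {a : Fin n → Fin n} {X : Matrix (Fin n) (Fin n) F}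
  {H : Matrix κ (Fin n) F} {v : Fin n → κ → F}

theorem rowSpace_eq_of_linearIndependent {ι : Type*} [Fintype ι]
    {D : Submodule F (Fin n → F)} {A : Matrix ι (Fin n) F} (hA : LinearIndependent F A.row)
    (hmem : ∀ l, A l ∈ D) (hcard : Fintype.card ι = Module.finrank F D) : rowSpace A = D := by
  refine Submodule.eq_of_le_of_finrank_eq ?_ ?_
  · rw [rowSpace, Submodule.span_le]
    rintro _ ⟨l, rfl⟩
    exact hmem l
  · rw [rowSpace, finrank_span_eq_card hA, hcard]

theorem exists_linearIndependent_selectRows (X : Matrix (Fin n) (Fin n) F) :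
    ∃ K : Finset (Fin n), K.card = Module.finrank F (rowSpace X) ∧
      LinearIndependent F (selectRows X K).row := by
  classical
  obtain ⟨κ, s, hs, hspan, hli⟩ := exists_linearIndependent' F X.row
  have : Fintype κ := Fintype.ofInjective s hs
  refine ⟨Finset.univ.image s, ?_, ?_⟩
  · rw [rowSpace, ← hspan, finrank_span_eq_card hli, Finset.card_image_of_injective _ hs,
      Finset.card_univ]
  · have hex : ∀ l : ↥(Finset.univ.image s), ∃ i, s i = l := fun l => by
      obtain ⟨i, -, hi⟩ := Finset.mem_image.1 l.2
      exact ⟨i, hi⟩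
    choose g hg using hex
    have hginj : Function.Injective g := fun l l' h => Subtype.ext (by rw [← hg, h, hg])
    have hcomp := hli.comp g hginj
    have hrow : (X.row ∘ s) ∘ g = (selectRows X (Finset.univ.image s)).row :=
      funext fun l => congrArg X (hg l)
    rwa [hrow] at hcomp

theorem dualMatrix_row_mem (hH : IsGenParity C X H) (m : Fin n) :
    dualMatrix H v m ∈ dualCode C :=
  vecMul_mem_dualCode (fun c hc => (hH.mem_iff c).1 hc) (v m)

theorem stateRow_dotProduct (X : Matrix (Fin n) (Fin n) F) (H : Matrix κ (Fin n) F)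
    (a : Fin n → Fin n) (j l : Fin n) (w : κ → F) :
    stateRow X H a j l ⬝ᵥ w =
      ∑ i ∈ Finset.univ.filter (fun i => a l ≤ i), X l i * (w ᵥ* H) i +
      ∑ i ∈ Finset.univ.filter (fun i => i < j), X l i * (w ᵥ* H) i := by
  have key : ∀ i, (X l i • H.col i) ⬝ᵥ w = X l i * (w ᵥ* H) i := fun i => by
    rw [smul_dotProduct, dotProduct_comm]
    rfl
  have hsum : ∀ s : Finset (Fin n),
      (∑ i ∈ s, X l i • H.col i) ⬝ᵥ w = ∑ i ∈ s, X l i * (w ᵥ* H) i := fun s =>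
    (sum_dotProduct _ _ _).trans (Finset.sum_congr rfl fun i _ => key i)
  rw [stateRow, stateMatrix_row, add_dotProduct]
  exact congrArg₂ (· + ·) (hsum (Finset.univ.filter (fun i => a l ≤ i))) (hsum _)

variable [NeZero n]

/-- If the rows of `X` with index in `K` generate `C`, then the rows of the dual matrix with index
outside `K` are linearly independent. -/
theorem linearIndependent_selectRows_dualMatrix (hX : IsCharPair C X (fun l => (a l, l)))
    (hH : IsGenParity C X H) (ha : ∀ m, a m ≠ m)
    (hv : ∀ m, IsDualState X H (fun l => (a l, l)) m (v m)) {K : Finset (Fin n)}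
    (hK : rowSpace (selectRows X K) = C) :
    LinearIndependent F (selectRows (dualMatrix H v) Kᶜ).row := by
  rw [Fintype.linearIndependent_iff]
  intro g hg m
  have hg0 : ∑ i : ↥Kᶜ, g i • v i = 0 := by
    refine eq_zero_of_vecMul_eq_zero hH.linearIndependent ?_
    rw [← hg, sum_vecMul]
    exact Finset.sum_congr rfl fun i _ => smul_vecMul _ _ _
  -- On row `l` this functional equals the combination of the pairings at the times `i`: the
  -- displacement part depends on `i` only through `v i` and cancels by `hg0`. Of that combination
  -- only the term `i = l` survives, so `φ` kills the rows in `K`, hence `C`, and each `g` must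
  -- vanish.
  let φ : (Fin n → F) →ₗ[F] F := ∑ i : ↥Kᶜ, g i •
    ∑ j ∈ Finset.univ.filter (fun j => j < (i : Fin n)),
      (v i ᵥ* H) j • LinearMap.proj (R := F) (φ := fun _ : Fin n => F) j
  have hφ : ∀ l, φ (X l) = ∑ i : ↥Kᶜ, g i * (stateRow X H a i l ⬝ᵥ v i) := by
    intro l
    have hA : ∑ i : ↥Kᶜ, g i * ∑ j ∈ Finset.univ.filter (fun j => a l ≤ j),
        X l j * (v i ᵥ* H) j = 0 := by
      have h1 : ∀ i : ↥Kᶜ, ∑ j ∈ Finset.univ.filter (fun j => a l ≤ j),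
          X l j * (v i ᵥ* H) j = (ofSpans X H (fun l => (a l, l))).D l ⬝ᵥ v i := by
        intro i
        refine ((sum_dotProduct _ _ _).trans (Finset.sum_congr rfl fun j _ => ?_)).symm
        rw [smul_dotProduct, dotProduct_comm]
        rfl
      have h2 := congrArg (fun w => (ofSpans X H (fun l => (a l, l))).D l ⬝ᵥ w) hg0
      simp only [dotProduct_sum, dotProduct_smul, dotProduct_zero, smul_eq_mul] at h2
      rw [← h2]
      exact Finset.sum_congr rfl fun i _ => by rw [h1]
    simp only [stateRow_dotProduct, mul_add, Finset.sum_add_distrib]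
    rw [hA, zero_add]
    simp [φ, LinearMap.sum_apply, mul_comm]
  have hsel : ∀ l, φ (X l) = if h : l ∈ Kᶜ then g ⟨l, h⟩ * (stateRow X H a l l ⬝ᵥ v l) else 0 := by
    intro l
    have hne : ∀ i : ↥Kᶜ, (i : Fin n) ≠ l → g i * (stateRow X H a i l ⬝ᵥ v i) = 0 := by
      intro i hi
      rw [stateRow_dotProduct_self_eq_zero hX hH (ha _) (hv _) hi.symm, mul_zero]
    rw [hφ]
    split_ifs with h
    · refine Finset.sum_eq_single ⟨l, h⟩ (fun i _ hi => hne i fun h' => hi (Subtype.ext h')) ?_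
      simp
    · refine Finset.sum_eq_zero fun i _ => hne i ?_
      rintro rfl
      exact h i.2
  have hle : rowSpace (selectRows X K) ≤ LinearMap.ker φ := by
    rw [rowSpace, Submodule.span_le]
    rintro _ ⟨l, rfl⟩
    have := hsel l
    rw [dif_neg (by simp)] at this
    exact this
  have hm : X m ∈ rowSpace (selectRows X K) := by
    rw [hK, ← hX.rowSpace_eq]
    exact Submodule.subset_span ⟨_, rfl⟩
  have h0 : φ (X m) = 0 := hle hm
  rw [hsel, dif_pos m.2] at h0
  exact (mul_eq_zero.1 h0).resolve_right (stateRow_dotProduct_ne_zero hX hH (ha _) (hv _))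

theorem isCharPair_dualMatrix (hX : IsCharPair C X (fun l => (a l, l)))
    (hH : IsGenParity C X H)
    (ha : ∀ m, a m ≠ m) (hv : ∀ m, IsDualState X H (fun l => (a l, l)) m (v m)) :
    IsCharPair (dualCode C) (dualMatrix H v) (fun m => (m, a m)) := by
  have hdim := finrank_add_finrank_dualCode C
  refine ⟨le_antisymm ?_ ?_, fun m => isSpan_vecMul hX hH (ha m) (hv m), fun _ _ h => h,
    hX.start_injective, fun j => ?_⟩
  · rw [rowSpace, Submodule.span_le]
    rintro _ ⟨m, rfl⟩
    exact dualMatrix_row_mem hH m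
  · obtain ⟨K, hcard, hli⟩ := exists_linearIndependent_selectRows X
    rw [hX.rowSpace_eq] at hcard
    have hK : rowSpace (selectRows X K) = C := rowSpace_eq_of_linearIndependent hli
      (fun l => hX.rowSpace_eq ▸ Submodule.subset_span ⟨l, rfl⟩) (by simpa using hcard)
    have hY : rowSpace (selectRows (dualMatrix H v) Kᶜ) = dualCode C :=
      rowSpace_eq_of_linearIndependent
        (linearIndependent_selectRows_dualMatrix hX hH ha hv hK)
        (fun l => dualMatrix_row_mem hH _)
        (by rw [Fintype.card_coe, Finset.card_compl, Fintype.card_fin]; omega)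
    rw [← hY]
    refine Submodule.span_mono ?_
    rintro _ ⟨l, rfl⟩
    exact ⟨l, rfl⟩
  · have h1 := hX.card_active j
    -- Since `(m, a m]` and `(a m, m]` are complementary, the count is `n - (n - dim C)`.
    have h2 : Finset.univ.filter (fun m => j ∈ cIoc m (a m)) =
        (Finset.univ.filter (fun l => j ∈ cIoc (a l) l))ᶜ := by
      ext m
      simp [mem_cIoc_swap (ha m)]
    dsimp only at h1 ⊢
    rw [h2, Finset.card_compl, h1, Fintype.card_fin]
    omega

/-- The zero pairing at time `m` and the orthogonality of `X l` and `Y m` share the partial sum over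
`i < m`; cancelling it equates the sums over `i ≥ a l` and `i ≥ m`. Disjointness of `K` and `Kᶜ`
supplies `l ≠ m`. -/
theorem dual_ofSpans_selectRows (hX : IsCharPair C X (fun l => (a l, l)))
    (hH : IsGenParity C X H) (ha : ∀ m, a m ≠ m)
    (hv : ∀ m, IsDualState X H (fun l => (a l, l)) m (v m)) (K : Finset (Fin n)) :
    (ofSpans (selectRows X K) (selectRows (dualMatrix H v) Kᶜ)
      (fun l => (a l, (l : Fin n)))).dual =
    ofSpans (selectRows (dualMatrix H v) Kᶜ) (selectRows X K)
      (fun m => ((m : Fin n), a m)) := by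
  refine TrellisData.ext rfl rfl ?_
  ext m l
  have hml : (l : Fin n) ≠ m := fun h => Finset.mem_compl.1 m.2 (h ▸ l.2)
  have h1 := stateRow_dotProduct_self_eq_zero hX hH (ha m) (hv m) hml
  have h2 : ∑ i, X l i * (v m ᵥ* H) i = 0 := dualMatrix_row_mem hH (m : Fin n) (X l)
    (hX.rowSpace_eq ▸ Submodule.subset_span ⟨l, rfl⟩)
  rw [stateRow_dotProduct] at h1
  rw [← Finset.sum_filter_add_sum_filter_not Finset.univ (fun i => (m : Fin n) ≤ i)] at h2
  simp only [not_le] at h2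
  have h3 := add_right_cancel (h1.trans h2.symm)
  simpa [TrellisData.dual, ofSpans, selectRows, dualMatrix, Finset.sum_apply, mul_comm] using h3

end Duality

end TailBiting

open TailBiting

theorem theorem4p10 {F : Type*} [Field F] {n k : ℕ} [NeZero n]
    (C : Submodule F (Fin n → F)) (hk : Module.finrank F C = k)
    (hC : TailBiting.HasFullSupport C)
    (hC' : TailBiting.HasFullSupport (TailBiting.dualCode C))
    (a : Fin n → Fin n) (X : Matrix (Fin n) (Fin n) F)
    (hX : TailBiting.IsCharPair C X (fun l => (a l, l)))
    (H : Matrix (Fin (n - k)) (Fin n) F) (hH : TailBiting.IsGenParity C X H) :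
    -- the construction of the dual characteristic matrix is well defined
    (∀ m, ∃! v, TailBiting.IsDualState X H (fun l => (a l, l)) m v) ∧
    ∀ v : Fin n → Fin (n - k) → F,
      (∀ m, TailBiting.IsDualState X H (fun l => (a l, l)) m (v m)) →
      TailBiting.IsCharPair (TailBiting.dualCode C) (TailBiting.dualMatrix H v)
        (fun m => (m, a m)) ∧
      ∀ (K : Finset (Fin n)) (Xt : Matrix K (Fin n) F) (Yt : Matrix ↥(Kᶜ) (Fin n) F),
        K.card = k →
        Xt = TailBiting.selectRows X K →
        Yt = TailBiting.selectRows (TailBiting.dualMatrix H v) Kᶜ →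
        Xt.rank = k →
        -- the selected matrices generate the two codes and check each other
        TailBiting.IsGenParity C Xt Yt ∧
        TailBiting.IsGenParity (TailBiting.dualCode C) Yt Xt ∧
        -- the duality of the trellises
        (TailBiting.TrellisData.ofSpans Xt Yt (fun l => (a l, (l : Fin n)))).dual.trellis =
          (TailBiting.TrellisData.ofSpans Yt Xt (fun m => ((m : Fin n), a m))).trellis := by
  have hκ : Fintype.card (Fin (n - k)) = n - Module.finrank F C := by rw [Fintype.card_fin, hk]
  have ha := hX.start_ne hC'
  have hdim := finrank_add_finrank_dualCode C
  refine ⟨existsUnique_isDualState hX hH hκ, fun v hv =>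
    ⟨isCharPair_dualMatrix hX hH ha hv, ?_⟩⟩
  rintro K Xt Yt hcard rfl rfl hrank
  have hXli : LinearIndependent F (selectRows X K).row := by
    rw [linearIndependent_iff_card_eq_finrank_span, Fintype.card_coe, hcard, ← hrank]
    exact Matrix.rank_eq_finrank_span_row _
  have hXK : rowSpace (selectRows X K) = C := rowSpace_eq_of_linearIndependent hXli
    (fun l => hX.rowSpace_eq ▸ Submodule.subset_span ⟨l, rfl⟩)
    (by rw [Fintype.card_coe, hcard, hk])
  have hYli := linearIndependent_selectRows_dualMatrix hX hH ha hv hXK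
  have hYK : rowSpace (selectRows (dualMatrix H v) Kᶜ) = dualCode C :=
    rowSpace_eq_of_linearIndependent hYli (fun l => dualMatrix_row_mem hH _)
      (by rw [Fintype.card_coe, Finset.card_compl, Fintype.card_fin]; omega)
  refine ⟨isGenParity_of_rowSpace_eq hXK hYK hYli,
    isGenParity_of_rowSpace_eq hYK ((dualCode_dualCode C).symm ▸ hXK) hXli, ?_⟩
  rw [dual_ofSpans_selectRows hX hH ha hv K]
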